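/- Let $T>0$, let $D\subset\mathbb{R}^d$ be a bounded Lipschitz domain, and put $Q:=(0,T)\times D$ and $\bar Q:=[0,T]\times\bar D$. Let $b\in L^\infty(\bar Q;\mathbb{R}^d)$ be a (concretely chosen) velocity field. Its Filippov set-valued map is $$F_b(t,x):=\bigcap_{|\xi|=1}\Big\{v\in\mathbb{R}^d:\ \xi\cdot v\le \lim_{\delta\to0+}\ \operatorname*{ess\,sup}_{y\in B_\delta(x)\cap\bar D}\xi\cdot b(t,y)\Big\},\qquad (t,x)\in\bar Q,$$ and a Filippov solution of $\dot\gamma=b(t,\gamma)$, $\gamma(0)=x$, is an absolutely continuous curve $\gamma:[0,T]\to\bar D$ with $\gamma(0)=x$ and $\dot\gamma(t)\in F_b(t,\gamma(t))$ for a.e. $t\in[0,T]$. Let $X:\bar Q\to\bar D$ be a map such that 1. for every $t\in[0,T]$ the map $x\mapsto X(t,x)$ is Borel measurable; 2. for every $x\in\bar D$ the curve $t\mapsto X(t,x)$ is a Filippov solution of $\dot\gamma=b(t,\gamma)$, $\gamma(0)=x$; 3. the flow lines are forward untangled: if $s\in[0,T]$, $x_1,x_2\in\bar D$ and $X(s,x_1)=X(s,x_2)$,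 then $X(t,x_1)=X(t,x_2)$ for all $t\in[s,T]$. Let $\varrho(t,\cdot):=X(t,\cdot)\#(\mathcal{L}^d\llcorner D)$ be the push-forward of Lebesgue measure on $D$, and let $\sigma(dz,dt):=\varrho(t,dz)\,dt$ be the associated space-time measure on $\bar Q$. Let $c\in L^\infty(\bar Q,\sigma)$ with $c\ge0$ $\sigma$-a.e., $f\in L^2(\bar Q,\sigma)$ and $\bar u\in L^2(D)$, and set $$C(t,x):=c(t,X(t,x)),\qquad F(t,x):=f(t,X(t,x)),\qquad (t,x)\in Q.$$ Let $\mathscr{C}^1_+$ be the space of all $V\in C(\bar Q)\cap C^1(Q)$ with $V(T,\cdot)=0$ and $\|V\|_*:=\|-\partial_tV+CV\|_{L^2(Q)}<\infty$, and let $\mathscr{Y}$ be its closure with respect to $\|\cdot\|_*$. Let $\mathcal{B}^*:\mathscr{Y}\to L^2(Q)$ be the continuous extension of $V\mapsto-\partial_tV+CV$, and for $V\in\mathscr{Y}$ let $V_0\in L^2(D)$ be its trace on $\{0\}\times D$ (the continuous extension of $V\mapsto V(0,\cdot)$). A variational solution of $\partial_tU+CU=F$ in $Q$, $U(0,\cdot)=\bar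 u$ in $D$, is a function $U\in L^2(Q)$ with $$\langle U,\mathcal{B}^*V\rangle_{L^2(Q)}=\langle F,V\rangle_{L^2(Q)}+\int_D\bar u(x)\,V_0(x)\,dx\qquad\text{for all }V\in\mathscr{Y}.$$ A function $u\in L^2(\bar Q,\sigma)$ is called a flow-solution of $$\partial_tu+b\cdot\nabla u+cu=f\ \text{ in }\bar Q,\qquad u(0,\cdot)=\bar u\ \text{ in }D,$$ if there is a variational solution $U\in L^2(Q)$ of $\partial_tU+CU=F$, $U(0,\cdot)=\bar u$, such that $$\iint_{\bar Q}u(t,z)\,\varphi(t,z)\,\varrho(t,dz)\,dt=\iint_QU(t,x)\,\varphi(t,X(t,x))\,dx\,dt\qquad\text{for all }\varphi\in C(\bar Q).$$ **Theorem.** Under these assumptions there exists exactly one flow-solution $u\in L^2(\bar Q,\sigma)$ (unique as an element of $L^2(\bar Q,\sigma)$, i.e. up to $\sigma$-null sets). -/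

import Mathlib

open MeasureTheory Set Filter Topology
open scoped NNReal ENNReal

noncomputable section

namespace FlowTransport

/-- Euclidean space `ℝ^d`; space-time points are pairs `(t, x) : ℝ × Space d`. -/
abbrev Space (d : ℕ) := EuclideanSpace ℝ (Fin d)

/-- A bounded Lipschitz domain: a nonempty bounded open set which, near each of its boundary
points, is the region strictly above the graph of a Lipschitz function, in some direction `ν`.
(`y - ⟪ν, y⟫ ν` is the orthogonal projection of `y` to the hyperplane `ν^⊥`.) Connectedness,
which is sometimes part of the word domain, is not required. -/
structure IsBoundedLipschitzDomain {d : ℕ} (D : Set (Space d)) : Prop where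
  isOpen : IsOpen D
  nonempty : D.Nonempty
  bounded : Bornology.IsBounded D
  lipschitz_boundary : ∀ x ∈ frontier D, ∃ ν : Space d, ‖ν‖ = 1 ∧ ∃ r > 0, ∃ K : ℝ≥0,
    ∃ g : Space d → ℝ, LipschitzWith K g ∧
      ∀ y ∈ Metric.ball x r, y ∈ D ↔ g (y - inner ℝ ν y • ν) < inner ℝ ν y

/-- The open cylinder `Q = (0,T) × D`. -/
def cylinder {d : ℕ} (T : ℝ) (D : Set (Space d)) : Set (ℝ × Space d) := Ioo 0 T ×ˢ D

/-- The closed cylinder `[0,T] × closure D`. -/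
def closedCylinder {d : ℕ} (T : ℝ) (D : Set (Space d)) : Set (ℝ × Space d) :=
  Icc 0 T ×ˢ closure D

/-! ### Filippov solutions and flows -/

/-- `h_δ(t,x,ξ)`, the essential supremum of `ξ · b(t,y)` over `y ∈ B_δ(x) ∩ Ω`. -/
def essSupport {d : ℕ} (Ω : Set (Space d)) (b : ℝ × Space d → Space d) (δ t : ℝ)
    (x ξ : Space d) : EReal :=
  essSup (fun y => ((inner ℝ ξ (b (t, y)) : ℝ) : EReal))
    (volume.restrict (Metric.ball x δ ∩ Ω))

/-- The essential supporting function `h(t,x,ξ) = lim_{δ → 0} h_δ(t,x,ξ)`. As `h_δ` is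
monotone in `δ`, the limit is the infimum over `δ > 0`. -/
def essSupportLim {d : ℕ} (Ω : Set (Space d)) (b : ℝ × Space d → Space d) (t : ℝ)
    (x ξ : Space d) : EReal :=
  ⨅ (δ : ℝ) (_ : 0 < δ), essSupport Ω b δ t x ξ

/-- The Filippov set-valued map
`F(t,x) = ⋂_{|ξ| = 1} { v | ξ · v ≤ h(t,x,ξ) }` of the velocity field `b`. -/
def filippovSet {d : ℕ} (Ω : Set (Space d)) (b : ℝ × Space d → Space d) (t : ℝ)
    (x : Space d) : Set (Space d) :=
  {v | ∀ ξ : Space d, ‖ξ‖ = 1 → ((inner ℝ ξ v : ℝ) : EReal) ≤ essSupportLim Ω b t x ξ}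

/-- `γ : [0,T] → Ω` is a Filippov solution of `γ' = b(t,γ)`, `γ(0) = x`: it is absolutely
continuous and `γ'(t) ∈ F(t,γ(t))` for almost every `t ∈ [0,T]`. -/
structure IsFilippovSolution {d : ℕ} (T : ℝ) (Ω : Set (Space d))
    (b : ℝ × Space d → Space d) (x : Space d) (γ : ℝ → Space d) : Prop where
  mem : ∀ t ∈ Icc 0 T, γ t ∈ Ω
  absCont : AbsolutelyContinuousOnInterval γ 0 T
  initial : γ 0 = x
  inclusion : ∀ᵐ t ∂(volume.restrict (Icc 0 T)),
    ∃ v ∈ filippovSet Ω b t (γ t), HasDerivAt γ v t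

/-- `X : [0,T] × closure D → closure D` is a Borel, forward untangled Filippov flow of `b`.
Only the values of `X` on `[0,T] × closure D` matter; that they lie in `closure D` is part of
`IsFilippovSolution`. -/
structure IsForwardUntangledFlow {d : ℕ} (T : ℝ) (D : Set (Space d))
    (b : ℝ × Space d → Space d) (X : ℝ → Space d → Space d) : Prop where
  borel : ∀ t ∈ Icc 0 T, Measurable (fun x : closure D => X t x)
  filippov : ∀ x ∈ closure D, IsFilippovSolution T (closure D) b x (fun t => X t x)
  untangled : ∀ s ∈ Icc 0 T, ∀ x₁ ∈ closure D, ∀ x₂ ∈ closure D, X s x₁ = X s x₂ →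
    ∀ t ∈ Icc s T, X t x₁ = X t x₂

/-- The density `ϱ(t,·) = X(t,·) # (L^d ⌞ D)`. -/
def density {d : ℕ} (D : Set (Space d)) (X : ℝ → Space d → Space d) (t : ℝ) :
    Measure (Space d) :=
  (volume.restrict D).map (X t)

/-- The space-time measure `σ(dz,dt) = ϱ(t,dz) dt` on `[0,T] × closure D`, that is
`σ(A) = ∫_0^T ϱ(t, {z | (t,z) ∈ A}) dt`. -/
def spaceTimeMeasure {d : ℕ} (T : ℝ) (D : Set (Space d)) (X : ℝ → Space d → Space d) :
    Measure (ℝ × Space d) :=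
  (volume.restrict (Icc 0 T)).bind (fun t => (density D X t).map (Prod.mk t))

/-! ### Variational solutions of `∂_t U + C U = F`, `U(0,·) = Ubar` -/

/-- The formal adjoint `B_∘^* V = -∂_t V + C V`. -/
def formalAdjoint {d : ℕ} (C V : ℝ × Space d → ℝ) : ℝ × Space d → ℝ :=
  fun p => -deriv (fun s => V (s, p.2)) p.1 + C p * V p

/-- The functions `V ∈ C(closure Q) ∩ C^1(Q)` with `V(T,·) = 0` whose graph norm
`‖V‖_* = ‖B_∘^* V‖_{L^2(Q)}` is finite. -/
structure IsSmoothTest {d : ℕ} (T : ℝ) (D : Set (Space d)) (C V : ℝ × Space d → ℝ) :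
    Prop where
  continuousOn : ContinuousOn V (closedCylinder T D)
  contDiffOn : ContDiffOn ℝ 1 V (cylinder T D)
  terminal : ∀ x ∈ closure D, V (T, x) = 0
  memLp : MemLp (formalAdjoint C V) 2 (volume.restrict (cylinder T D))

/-- `V` belongs to the test space `Y`, the closure of the smooth test functions in the graph
norm; `G = B^* V` is the continuous extension of `B_∘^*` at `V`, and `V₀ ∈ L^2(D)` is the trace
of `V` on `{0} × D`, the continuous extension of `V ↦ V(0,·)`. The `L^2(Q)` norm of a smooth test
function and the `L^2(D)` norm of its trace are bounded by a multiple of its graph norm, so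
convergence of `B_∘^* V_n` alone forces that of `V_n` and of `V_n(0,·)`: every element of the
abstract completion is represented by exactly one triple `(V, G, V₀)` up to null sets. -/
structure InTestSpace {d : ℕ} (T : ℝ) (D : Set (Space d)) (C V G : ℝ × Space d → ℝ)
    (V₀ : Space d → ℝ) : Prop where
  memLp : MemLp V 2 (volume.restrict (cylinder T D))
  memLp_adjoint : MemLp G 2 (volume.restrict (cylinder T D))
  memLp_trace : MemLp V₀ 2 (volume.restrict D)
  approx : ∃ W : ℕ → ℝ × Space d → ℝ, (∀ n, IsSmoothTest T D C (W n)) ∧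
    Tendsto (fun n => eLpNorm (W n - V) 2 (volume.restrict (cylinder T D))) atTop (𝓝 0) ∧
    Tendsto (fun n => eLpNorm (formalAdjoint C (W n) - G) 2
      (volume.restrict (cylinder T D))) atTop (𝓝 0) ∧
    Tendsto (fun n => eLpNorm ((fun x => W n (0, x)) - V₀) 2 (volume.restrict D)) atTop (𝓝 0)

/-- `U ∈ L^2(Q)` is a variational solution of `∂_t U + C U = F`, `U(0,·) = Ubar`:
`⟨U, B^* V⟩_{L^2(Q)} = ⟨F, V⟩_{L^2(Q)} + ∫_D Ubar V₀ dx` for all `V ∈ Y`. -/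
structure IsVariationalSolution {d : ℕ} (T : ℝ) (D : Set (Space d))
    (C F : ℝ × Space d → ℝ) (Ubar : Space d → ℝ) (U : ℝ × Space d → ℝ) : Prop where
  memLp : MemLp U 2 (volume.restrict (cylinder T D))
  variational : ∀ (V G : ℝ × Space d → ℝ) (V₀ : Space d → ℝ), InTestSpace T D C V G V₀ →
    ∫ p in cylinder T D, U p * G p =
      (∫ p in cylinder T D, F p * V p) + ∫ x in D, Ubar x * V₀ x

/-! ### Flow-solutions -/

/-- The pull-back `(t,x) ↦ g(t, X(t,x))`. -/
def alongFlow {d : ℕ} (X : ℝ → Space d → Space d) (g : ℝ × Space d → ℝ) :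
    ℝ × Space d → ℝ :=
  fun p => g (p.1, X p.1 p.2)

/-- `u ∈ L^2(σ)` is a flow-solution of `∂_t u + b · ∇u + c u = f`, `u(0,·) = ubar`, for the flow
`X` of `b`. -/
structure IsFlowSolution {d : ℕ} (T : ℝ) (D : Set (Space d)) (X : ℝ → Space d → Space d)
    (c f : ℝ × Space d → ℝ) (ubar : Space d → ℝ) (u : ℝ × Space d → ℝ) : Prop where
  memLp : MemLp u 2 (spaceTimeMeasure T D X)
  generated : ∃ U : ℝ × Space d → ℝ,
    IsVariationalSolution T D (alongFlow X c) (alongFlow X f) ubar U ∧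
    ∀ φ : ℝ × Space d → ℝ, ContinuousOn φ (closedCylinder T D) →
      ∫ p, u p * φ p ∂(spaceTimeMeasure T D X) =
        ∫ p in cylinder T D, U p * alongFlow X φ p

end FlowTransport

end

namespace FlowTransport

variable {d : ℕ} {T : ℝ} {D : Set (Space d)}

/-! The map `Φ (t, x) = (t, X t x)` carries Lebesgue measure on the cylinder to the space-time
measure `σ`: this is Fubini, once the flow, measurable in space and continuous in time, is known to
be jointly measurable (`exists_measurePreserving_alongFlow`). Hence `g ↦ g ∘ Φ` is an isometry from
`L²(σ)` into `L²(Q)`. The identity defining a flow-solution says that `u` is the image of `U` under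
the adjoint of this isometry, so `U` determines `u`: continuous functions separate `L²(σ)`. The
theorem thus reduces to existence and uniqueness of the variational solution `U`.

That problem has no derivative in `x` and splits into linear equations `U' + C U = F` along the
lines of fixed `x`. For existence, the variation of constants formula is tested against smooth `V`
by integrating by parts in time (`integral_variationOfConstants_mul`); the general test functions
follow by passing to the limit. For uniqueness, the difference `W` of two solutions is orthogonal to
every `-∂_t V + c V`. Taking for `V` the backward time primitive of an arbitrary bump function `g`
and integrating by parts gives `W + ∫₀ᵗ c W = 0` almost everywhere, and an integrating factor forces
`W = 0` (`ae_eq_zero_of_integral_mul_formalAdjoint`). -/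

/-! ### Transport of Lebesgue measure by the flow -/

theorem volume_restrict_cylinder :
    volume.restrict (cylinder T D) =
      (volume.restrict (Ioo 0 T)).prod (volume.restrict D) := by
  rw [cylinder, Measure.volume_eq_prod, Measure.prod_restrict]

theorem isFiniteMeasure_restrict (hD : IsBoundedLipschitzDomain D) :
    IsFiniteMeasure (volume.restrict D) :=
  ⟨by simpa using hD.bounded.measure_lt_top⟩

theorem isFiniteMeasure_restrict_cylinder (hD : IsBoundedLipschitzDomain D) :
    IsFiniteMeasure (volume.restrict (cylinder T D)) := by
  have := isFiniteMeasure_restrict hD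
  rw [volume_restrict_cylinder]
  infer_instance

theorem measurableSet_cylinder (hD : IsBoundedLipschitzDomain D) :
    MeasurableSet (cylinder T D) :=
  measurableSet_Ioo.prod hD.isOpen.measurableSet

/-- A flow which is measurable in space and continuous in time has a jointly measurable version
on the cylinder, and that version transports Lebesgue measure to the space-time measure. -/
theorem exists_measurePreserving_alongFlow (hT : 0 < T) (hD : IsBoundedLipschitzDomain D)
    {b : ℝ × Space d → Space d} {X : ℝ → Space d → Space d}
    (hX : IsForwardUntangledFlow T D b X) :
    ∃ Φ : ℝ × Space d → ℝ × Space d,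
      MeasurePreserving Φ (volume.restrict (cylinder T D)) (spaceTimeMeasure T D X) ∧
      ∀ p ∈ cylinder T D, Φ p = (p.1, X p.1 p.2) := by
  classical
  have hDm := hD.isOpen.measurableSet
  have hfin := isFiniteMeasure_restrict hD
  -- Clamping time to `[0,T]` makes each trajectory continuous on all of `ℝ`, so that continuity in
  -- `t` and measurability in `x` give joint measurability.
  let Y : ℝ → D → Space d := fun t x => X (projIcc 0 T hT.le t) x
  have hYc : ∀ x, Continuous fun t => Y t x := by
    intro x
    have h := (hX.filippov x (subset_closure x.2)).absCont.continuousOn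
    rw [uIcc_of_le hT.le] at h
    exact h.comp_continuous (continuous_subtype_val.comp continuous_projIcc) fun t => Subtype.mem _
  have hYm : ∀ t, Measurable (Y t) := fun t =>
    (hX.borel _ (projIcc 0 T hT.le t).2).comp (measurable_inclusion subset_closure)
  have hY : Measurable (Function.uncurry Y) := measurable_uncurry_of_continuous_of_measurable hYc hYm
  let Ψ : ℝ × Space d → Space d := fun p => if h : p.2 ∈ D then Y p.1 ⟨p.2, h⟩ else 0
  have hΨ : Measurable Ψ := by
    refine Measurable.dite (s := {p : ℝ × Space d | p.2 ∈ D}) (f := fun p => Y p.1.1 ⟨p.1.2, p.2⟩)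
      (g := fun _ => 0) ?_ measurable_const (measurable_snd hDm)
    exact hY.comp (f := fun p : {p : ℝ × Space d | p.2 ∈ D} => (p.1.1, (⟨p.1.2, p.2⟩ : D)))
      (by fun_prop)
  have hΨX : ∀ t ∈ Icc 0 T, ∀ x ∈ D, Ψ (t, x) = X t x := by
    intro t ht x hx
    simp [Ψ, hx, Y, projIcc_of_mem hT.le ht]
  let Φ : ℝ × Space d → ℝ × Space d := fun p => (p.1, Ψ p)
  have hΦ : Measurable Φ := measurable_fst.prodMk hΨ
  refine ⟨Φ, ⟨hΦ, ?_⟩, fun p hp => by simp [Φ, hΨX p.1 (Ioo_subset_Icc_self hp.1) p.2 hp.2]⟩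
  have hΦt : ∀ t, Measurable fun x => Φ (t, x) := fun t => hΦ.comp measurable_prodMk_left
  have hΨt : ∀ t, Measurable fun x => Ψ (t, x) := fun t => hΨ.comp measurable_prodMk_left
  have hmeas : Measurable fun t => (volume.restrict D).map (fun x => Φ (t, x)) := by
    refine Measure.measurable_of_measurable_coe _ fun s hs => ?_
    have h : ∀ t, (volume.restrict D).map (fun x => Φ (t, x)) s =
        (volume.restrict D) (Prod.mk t ⁻¹' (Φ ⁻¹' s)) := fun t => by
      rw [Measure.map_apply (hΦt t) hs]; rfl
    simp_rw [h]
    exact measurable_measure_prodMk_left (hΦ hs)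
  have hae : (fun t => (density D X t).map (Prod.mk t)) =ᵐ[volume.restrict (Icc 0 T)]
      fun t => (volume.restrict D).map (fun x => Φ (t, x)) := by
    refine (ae_restrict_iff' measurableSet_Icc).2 (.of_forall fun t ht => ?_)
    have h1 : X t =ᵐ[volume.restrict D] fun x => Ψ (t, x) :=
      (ae_restrict_iff' hDm).2 (.of_forall fun x hx => (hΨX t ht x hx).symm)
    simp only [density]
    rw [Measure.map_congr h1, Measure.map_map measurable_prodMk_left (hΨt t)]
    rfl
  ext s hs
  rw [Measure.map_apply hΦ hs, spaceTimeMeasure,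
    Measure.bind_apply hs (hmeas.aemeasurable.congr hae.symm), volume_restrict_cylinder,
    Measure.prod_apply (hΦ hs), restrict_Ioo_eq_restrict_Icc]
  refine lintegral_congr_ae (hae.mono fun t ht => ?_)
  simp only [ht]
  rw [Measure.map_apply (hΦt t) hs]
  rfl

/-- The element of `L²` of the target whose integrals against continuous functions are those of
`U` against their pull-backs: the adjoint of the pull-back applied to `U`. -/
theorem exists_Lp_integral_mul_eq {α β : Type*} [MeasurableSpace α] [MeasurableSpace β]
    {μ : Measure α} {σ : Measure β} {Φ : α → β} (hΦ : MeasurePreserving Φ μ σ)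
    {U : α → ℝ} (hU : MemLp U 2 μ) :
    ∃ u : Lp ℝ 2 σ, ∀ φ : β → ℝ, MemLp φ 2 σ →
      ∫ p, u p * φ p ∂σ = ∫ p, U p * φ (Φ p) ∂μ := by
  let L := (Lp.compMeasurePreservingₗᵢ ℝ (E := ℝ) (p := 2) Φ hΦ).toContinuousLinearMap
  refine ⟨ContinuousLinearMap.adjoint L (hU.toLp U), fun φ hφ => ?_⟩
  have h := ContinuousLinearMap.adjoint_inner_left L (hφ.toLp φ) (hU.toLp U)
  rw [L2.inner_def, L2.inner_def] at h
  have hL : L (hφ.toLp φ) =ᵐ[μ] fun p => φ (Φ p) :=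
    (Lp.coeFn_compMeasurePreserving _ hΦ).trans
      (hΦ.quasiMeasurePreserving.ae_eq_comp hφ.coeFn_toLp)
  calc _ = _ := integral_congr_ae (by
          filter_upwards [hφ.coeFn_toLp] with p hp
          rw [← hp]; simp [mul_comm])
    _ = _ := h
    _ = _ := integral_congr_ae (by
          filter_upwards [hL, hU.coeFn_toLp] with p hp hp'
          simp [hp, hp', mul_comm])

/-! ### Continuous test functions and the space-time measure -/

theorem ae_mem_closedCylinder {b : ℝ × Space d → Space d} {X : ℝ → Space d → Space d}
    (hD : IsBoundedLipschitzDomain D)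
    (hX : IsForwardUntangledFlow T D b X) {Φ : ℝ × Space d → ℝ × Space d}
    (hΦ : MeasurePreserving Φ (volume.restrict (cylinder T D)) (spaceTimeMeasure T D X))
    (hΦX : ∀ p ∈ cylinder T D, Φ p = (p.1, X p.1 p.2)) :
    ∀ᵐ p ∂(spaceTimeMeasure T D X), p ∈ closedCylinder T D := by
  have hm : MeasurableSet (closedCylinder T D) :=
    measurableSet_Icc.prod isClosed_closure.measurableSet
  rw [← hΦ.map_eq]
  refine (ae_map_iff hΦ.aemeasurable hm).2 ?_
  refine (ae_restrict_iff' (measurableSet_cylinder hD)).2 (.of_forall fun p hp => ?_)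
  rw [hΦX p hp]
  have ht := Ioo_subset_Icc_self hp.1
  exact ⟨ht, (hX.filippov p.2 (subset_closure hp.2)).mem _ ht⟩

theorem isCompact_closedCylinder (hD : IsBoundedLipschitzDomain D) :
    IsCompact (closedCylinder T D) :=
  isCompact_Icc.prod hD.bounded.isCompact_closure

theorem memLp_of_continuousOn_closedCylinder (hD : IsBoundedLipschitzDomain D)
    {σ : Measure (ℝ × Space d)} [IsFiniteMeasure σ] (hσ : ∀ᵐ p ∂σ, p ∈ closedCylinder T D)
    {φ : ℝ × Space d → ℝ} (hφ : ContinuousOn φ (closedCylinder T D)) (q : ℝ≥0∞) :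
    MemLp φ q σ := by
  have hc := isCompact_closedCylinder (T := T) hD
  obtain ⟨M, hM⟩ := hc.exists_bound_of_continuousOn hφ
  have h1 : AEStronglyMeasurable φ σ := by
    rw [← Measure.restrict_eq_self_of_ae_mem hσ]
    exact hφ.aestronglyMeasurable hc.measurableSet
  exact MemLp.of_bound h1 M (hσ.mono hM)

/-- Smooth compactly supported functions already separate locally integrable functions, and `L²` of
a finite measure consists of such functions. -/
theorem ae_eq_of_integral_mul_continuous_eq {σ : Measure (ℝ × Space d)} [IsFiniteMeasure σ]
    {u v : ℝ × Space d → ℝ} (hu : MemLp u 2 σ) (hv : MemLp v 2 σ)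
    (h : ∀ φ : ℝ × Space d → ℝ, Continuous φ → ∫ p, u p * φ p ∂σ = ∫ p, v p * φ p ∂σ) :
    u =ᵐ[σ] v := by
  refine ae_eq_of_integral_contDiff_smul_eq (hu.locallyIntegrable (by norm_num))
    (hv.locallyIntegrable (by norm_num)) fun g hg _ => ?_
  simpa [mul_comm] using h g hg.continuous

/-! ### The scalar linear equation with bounded measurable coefficient -/

theorem intervalIntegrable_of_measurable_of_bound {k : ℝ → ℝ} {M : ℝ} (hk : Measurable k)
    (hkM : ∀ t, ‖k t‖ ≤ M) (a b : ℝ) : IntervalIntegrable k volume a b := by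
  rw [intervalIntegrable_iff]
  exact Measure.integrableOn_of_bounded (M := M) (by simp) hk.aestronglyMeasurable
    (.of_forall hkM)

/-- The exponential of a primitive of a bounded function is absolutely continuous. -/
theorem absolutelyContinuousOnInterval_exp_integral {k : ℝ → ℝ} {M : ℝ} (hk : Measurable k)
    (hkM : ∀ t, ‖k t‖ ≤ M) (T : ℝ) :
    AbsolutelyContinuousOnInterval (fun t => Real.exp (∫ s in 0..t, k s)) 0 T := by
  have hM : 0 ≤ M := (norm_nonneg _).trans (hkM 0)
  have hi := intervalIntegrable_of_measurable_of_bound hk hkM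
  have hA : LipschitzOnWith ⟨M, hM⟩ (fun t => ∫ s in 0..t, k s) (uIcc 0 T) :=
    LipschitzOnWith.of_dist_le_mul fun x _ y _ => by
      rw [Real.dist_eq, intervalIntegral.integral_interval_sub_left (hi _ _) (hi _ _), Real.dist_eq]
      exact intervalIntegral.norm_integral_le_of_norm_le_const fun t _ => hkM t
  obtain ⟨B, hB⟩ := hA.absolutelyContinuousOnInterval.exists_bound
  -- The exponential is only locally Lipschitz; the bound `B` on the primitive confines it to a
  -- compact interval.
  obtain ⟨K, hK⟩ := (Real.contDiff_exp (n := 1)).contDiffOn.exists_lipschitzOnWith (by decide)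
    (convex_Icc (-B) B) isCompact_Icc
  exact (hK.comp hA fun t ht => abs_le.1 (hB t ht)).absolutelyContinuousOnInterval

/-- The derivative of the exponential of a primitive. -/
theorem ae_hasDerivAt_exp_integral {k : ℝ → ℝ} {M : ℝ} (hk : Measurable k)
    (hkM : ∀ t, ‖k t‖ ≤ M) :
    ∀ᵐ t, HasDerivAt (fun t => Real.exp (∫ s in 0..t, k s))
      (Real.exp (∫ s in 0..t, k s) * k t) t := by
  have h : LocallyIntegrable k volume := by
    refine (locallyIntegrable_const M).mono hk.aestronglyMeasurable (.of_forall fun t => ?_)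
    exact (hkM t).trans (Real.le_norm_self M)
  filter_upwards [_root_.LocallyIntegrable.ae_hasDerivAt_integral h] with t ht
  exact (ht 0).exp

/-- A solution of the homogeneous integral equation with bounded coefficient vanishes. -/
theorem ae_eq_zero_of_add_integral_eq_zero {T M : ℝ} (hT : 0 ≤ T) {c w : ℝ → ℝ}
    (hc : Measurable c) (hcM : ∀ t, ‖c t‖ ≤ M) (hw : IntegrableOn w (Ioo 0 T))
    (h : ∀ᵐ s ∂(volume.restrict (Ioo 0 T)), w s + ∫ t in 0..s, w t * c t = 0) :
    w =ᵐ[volume.restrict (Ioo 0 T)] 0 := by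
  have hwc : IntervalIntegrable (fun t => w t * c t) volume 0 T := by
    rw [intervalIntegrable_iff_integrableOn_Ioo_of_le hT]
    exact hw.mul_bdd (c := M) hc.aestronglyMeasurable (.of_forall hcM)
  have hz := hwc.absolutelyContinuousOnInterval_intervalIntegral (c := 0) (by simp)
  have hE := absolutelyContinuousOnInterval_exp_integral hc hcM T
  have hzero : ∀ s ∈ Icc 0 T, (∫ t in 0..s, w t * c t) = 0 := by
    intro s hs
    have hsub : uIcc 0 s ⊆ uIcc 0 T := by
      rw [uIcc_of_le hs.1, uIcc_of_le hT]; exact Icc_subset_Icc_right hs.2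
    -- With `z = ∫ w c` and `E = exp (∫ c)`, the hypothesis gives `(z E)' = c E (w + z) = 0` almost
    -- everywhere. Absolute continuity and `z 0 = 0` then yield `z = 0`.
    have hprod := ((hz.fun_mul hE).mono hsub).integral_deriv_eq_sub
    rw [intervalIntegral.integral_zero_ae] at hprod
    · simpa [Real.exp_ne_zero] using hprod.symm
    · have hends : ∀ᵐ t : ℝ, t ≠ T := by simp [ae_iff, measure_singleton]
      rw [ae_restrict_iff' measurableSet_Ioo] at h
      filter_upwards [h, hwc.ae_hasDerivAt_integral, ae_hasDerivAt_exp_integral hc hcM, hends]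
        with t h1 h2 h3 h4 ht
      rw [uIoc_of_le hs.1] at ht
      have ht' : t ∈ Ioo 0 T := ⟨ht.1, lt_of_le_of_ne (ht.2.trans hs.2) h4⟩
      have h5 := h2 (by rw [uIcc_of_le hT]; exact Ioo_subset_Icc_self ht') 0 (by simp)
      rw [(h5.fun_mul h3).deriv]
      linear_combination (c t * Real.exp (∫ s in 0..t, c s)) * h1 ht'
  filter_upwards [h, ae_restrict_mem measurableSet_Ioo] with s hs hs'
  simpa [hzero s (Ioo_subset_Icc_self hs')] using hs

theorem AbsolutelyContinuousOnInterval.congr {f g : ℝ → ℝ} {a b : ℝ}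
    (hf : AbsolutelyContinuousOnInterval f a b) (h : EqOn f g (uIcc a b)) :
    AbsolutelyContinuousOnInterval g a b := by
  rw [absolutelyContinuousOnInterval_iff] at hf ⊢
  intro ε hε
  obtain ⟨δ, hδ, H⟩ := hf ε hε
  refine ⟨δ, hδ, fun E hE hE' => ?_⟩
  refine lt_of_eq_of_lt (Finset.sum_congr rfl fun i hi => ?_) (H E hE hE')
  rw [h (hE.1 i hi).1, h (hE.1 i hi).2]

/-- The solution `u` of `u' + c u = f`, `u(0) = u₀` given by the variation of constants formula
satisfies the weak formulation of the equation. -/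
theorem integral_variationOfConstants_mul {T M : ℝ} (hT : 0 ≤ T) {c f v : ℝ → ℝ}
    (hc : Measurable c) (hcM : ∀ t, ‖c t‖ ≤ M) (hf : IntegrableOn f (Ioo 0 T))
    (hv : ContinuousOn v (Icc 0 T)) (hv' : ∀ t ∈ Ioo 0 T, DifferentiableAt ℝ v t)
    (hg : IntegrableOn (fun t => -deriv v t + c t * v t) (Ioo 0 T)) (hvT : v T = 0) (u₀ : ℝ) :
    ∫ t in Ioo 0 T, Real.exp (∫ s in 0..t, -c s) *
        (u₀ + ∫ s in 0..t, Real.exp (∫ r in 0..s, c r) * f s) * (-deriv v t + c t * v t) =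
      (∫ t in Ioo 0 T, f t * v t) + u₀ * v 0 := by
  have hI : ∀ φ : ℝ → ℝ, ∫ t in Ioo 0 T, φ t = ∫ t in 0..T, φ t := fun φ => by
    rw [intervalIntegral.integral_of_le hT, integral_Ioc_eq_integral_Ioo]
  have hIcc : uIcc 0 T = Icc 0 T := uIcc_of_le hT
  have hE := absolutelyContinuousOnInterval_exp_integral hc hcM T
  have hE' := absolutelyContinuousOnInterval_exp_integral (k := fun t => -c t) hc.neg
    (by simpa using hcM) T
  have hdE' := ae_hasDerivAt_exp_integral (k := fun t => -c t) hc.neg (by simpa using hcM)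
  have hcv : IntegrableOn (fun t => c t * v t) (Ioo 0 T) := by
    refine Integrable.bdd_mul (c := M) ?_ hc.aestronglyMeasurable (.of_forall hcM)
    exact (hv.integrableOn_Icc).mono_set Ioo_subset_Icc_self
  have hdv : IntervalIntegrable (deriv v) volume 0 T := by
    rw [intervalIntegrable_iff_integrableOn_Ioo_of_le hT]
    refine (hcv.sub hg).congr (.of_forall fun t => ?_)
    simp
  -- Differentiability is available only in the open interval, but `v' = c v - g` is integrable
  -- there, so `v` is the integral of its derivative up to the endpoints.
  have hvac : AbsolutelyContinuousOnInterval v 0 T := by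
    have h0 : AbsolutelyContinuousOnInterval (fun _ : ℝ => v 0) 0 T :=
      (LipschitzWith.const (v 0)).lipschitzOnWith.absolutelyContinuousOnInterval
    refine AbsolutelyContinuousOnInterval.congr
      (h0.add (hdv.absolutelyContinuousOnInterval_intervalIntegral (c := 0) (by simp))) ?_
    intro t ht
    rw [hIcc] at ht
    have hsub : Icc 0 t ⊆ Icc 0 T := Icc_subset_Icc_right ht.2
    have := intervalIntegral.integral_eq_sub_of_hasDerivAt_of_le ht.1 (hv.mono hsub)
      (fun s hs => (hv' s ⟨hs.1, hs.2.trans_le ht.2⟩).hasDerivAt)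
      (hdv.mono_set (by rwa [uIcc_of_le ht.1, hIcc]))
    simp [this]
  have hEf : IntervalIntegrable (fun s => Real.exp (∫ r in 0..s, c r) * f s) volume 0 T := by
    obtain ⟨B, hB⟩ := hE.exists_bound
    rw [intervalIntegrable_iff_integrableOn_Ioo_of_le hT]
    rw [hIcc] at hB
    refine Integrable.bdd_mul (c := B) hf ?_ ?_
    · exact (hE.continuousOn.mono (by rw [hIcc]; exact Ioo_subset_Icc_self)).aestronglyMeasurable
        measurableSet_Ioo
    · exact (ae_restrict_iff' measurableSet_Ioo).2
        (.of_forall fun t ht => hB t (Ioo_subset_Icc_self ht))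
  have hh0 : AbsolutelyContinuousOnInterval (fun _ : ℝ => u₀) 0 T :=
    (LipschitzWith.const u₀).lipschitzOnWith.absolutelyContinuousOnInterval
  have hh := hh0.add (hEf.absolutelyContinuousOnInterval_intervalIntegral (c := 0) (by simp))
  -- Write the solution as `e h` with `e = exp (-∫ c)`. Since `e (-v' + c v) = -(e v)'` and `e h' =
  -- f`, integrating `h (e v)'` by parts gives the claim; the boundary terms are `0` at `T` and `u₀
  -- * v 0` at `0`.
  have hparts := hh.integral_mul_deriv_eq_deriv_mul (hE'.fun_mul hvac)
  have hends : ∀ᵐ t : ℝ, t ≠ T := by simp [ae_iff, measure_singleton]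
  have h1 : ∫ t in 0..T, Real.exp (∫ s in 0..t, -c s) *
        (u₀ + ∫ s in 0..t, Real.exp (∫ r in 0..s, c r) * f s) * (-deriv v t + c t * v t) =
      -∫ t in 0..T, ((fun _ : ℝ => u₀) + fun t => ∫ s in 0..t, Real.exp (∫ r in 0..s, c r) * f s) t *
        deriv (fun t => Real.exp (∫ s in 0..t, -c s) * v t) t := by
    rw [← intervalIntegral.integral_neg]
    refine intervalIntegral.integral_congr_ae ?_
    filter_upwards [hdE', hends] with t h2 h3 ht
    rw [uIoc_of_le hT] at ht
    rw [(h2.fun_mul (hv' t ⟨ht.1, lt_of_le_of_ne ht.2 h3⟩).hasDerivAt).deriv]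
    simp only [Pi.add_apply]
    ring
  have h2 : ∫ t in 0..T, deriv ((fun _ : ℝ => u₀) +
        fun t => ∫ s in 0..t, Real.exp (∫ r in 0..s, c r) * f s) t *
        (Real.exp (∫ s in 0..t, -c s) * v t) = ∫ t in 0..T, f t * v t := by
    refine intervalIntegral.integral_congr_ae ?_
    filter_upwards [hEf.ae_hasDerivAt_integral] with t h3 ht
    have h4 := h3 (uIoc_subset_uIcc ht) 0 (by simp)
    rw [((hasDerivAt_const t u₀).add h4).deriv, intervalIntegral.integral_neg, Real.exp_neg]
    field_simp
    simp
  rw [hI, hI, h1, hparts, h2, hvT]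
  simp

/-! ### Existence of variational solutions -/

/-- The variable limit is moved into the integrand as the indicator of a measurable set of pairs
`(t, s)`, leaving a parametric integral over the whole line. Two such sets are needed because the
interval integral is oriented. -/
theorem measurable_integral_fst {E : Type*} [MeasurableSpace E] {f : ℝ × E → ℝ}
    (hf : Measurable f) : Measurable fun p : ℝ × E => ∫ s in 0..p.1, f (s, p.2) := by
  have key : ∀ S : Set (ℝ × ℝ), MeasurableSet S →
      Measurable fun p : ℝ × E => ∫ s, {s | (p.1, s) ∈ S}.indicator (fun s => f (s, p.2)) s := by
    intro S hS
    have h : Measurable fun q : (ℝ × E) × ℝ =>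
        {q : (ℝ × E) × ℝ | (q.1.1, q.2) ∈ S}.indicator (fun q => f (q.2, q.1.2)) q := by
      refine Measurable.indicator (by fun_prop) ?_
      exact (show Measurable fun q : (ℝ × E) × ℝ => (q.1.1, q.2) by fun_prop) hS
    exact h.stronglyMeasurable.integral_prod_right'.measurable
  have h1 := key {q | 0 < q.2 ∧ q.2 ≤ q.1} ((measurableSet_lt measurable_const measurable_snd).inter
    (measurableSet_le measurable_snd measurable_fst))
  have h2 := key {q | q.1 < q.2 ∧ q.2 ≤ 0} ((measurableSet_lt measurable_fst measurable_snd).inter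
    (measurableSet_le measurable_snd measurable_const))
  convert h1.sub h2 using 1
  ext p
  simp only [Pi.sub_apply, intervalIntegral]
  rw [← integral_indicator measurableSet_Ioc, ← integral_indicator measurableSet_Ioc]
  rfl

theorem ae_restrict_cylinder_of_ae {P : Space d → Prop} (h : ∀ᵐ x ∂(volume.restrict D), P x) :
    ∀ᵐ p ∂(volume.restrict (cylinder T D)), P p.2 := by
  rw [volume_restrict_cylinder]
  exact Measure.quasiMeasurePreserving_snd.ae h

/-- The time integral of a square integrable function on the cylinder is square integrable. -/
theorem memLp_integral_norm (hT : 0 < T) (hD : IsBoundedLipschitzDomain D) {f : ℝ × Space d → ℝ}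
    (hf : MemLp f 2 (volume.restrict (cylinder T D))) :
    MemLp (fun x => ∫ s in Ioo 0 T, ‖f (s, x)‖) 2 (volume.restrict D) := by
  have := isFiniteMeasure_restrict hD
  rw [volume_restrict_cylinder] at hf
  have h1 := (hf.integrable (by norm_num)).norm
  have h2 := (memLp_two_iff_integrable_sq_norm hf.1).1 hf
  have hm := h1.integral_prod_right.aestronglyMeasurable
  rw [memLp_two_iff_integrable_sq hm]
  refine (h2.integral_prod_right.const_mul T).mono' (hm.pow 2) ?_
  filter_upwards [h1.prod_left_ae, h2.prod_left_ae] with x hx1 hx2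
  set m := ∫ s in Ioo 0 T, ‖f (s, x)‖
  -- Cauchy–Schwarz in time, `m² ≤ T ∫ |f|²`, obtained by integrating `(|f| - m / T)² ≥ 0`.
  have h3 : ∫ s in Ioo 0 T, (2 * (m / T)) * ‖f (s, x)‖ ≤
      ∫ s in Ioo 0 T, (‖f (s, x)‖ ^ 2 + (m / T) ^ 2) :=
    integral_mono (hx1.const_mul _) (hx2.add (integrable_const _)) fun s => by
      nlinarith [sq_nonneg (‖f (s, x)‖ - m / T)]
  rw [integral_const_mul, integral_add hx2 (integrable_const _)] at h3
  have h4 : ∫ _ in Ioo 0 T, (m / T) ^ 2 = T * (m / T) ^ 2 := by simp [hT.le]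
  rw [h4] at h3
  rw [Real.norm_of_nonneg (sq_nonneg _)]
  have h5 : T * (m / T) ^ 2 = m ^ 2 / T := by field_simp
  have h6 : 2 * (m / T) * m = 2 * (m ^ 2 / T) := by ring
  have h7 : m ^ 2 / T ≤ ∫ s in Ioo 0 T, ‖f (s, x)‖ ^ 2 := by
    change 2 * (m / T) * m ≤ _ at h3
    linarith
  rwa [div_le_iff₀ hT, mul_comm] at h7

/-- The variation of constants formula for `∂_t U + c U = f`, `U(0,·) = ubar`. -/
noncomputable def variationOfConstants (c f : ℝ × Space d → ℝ) (ubar : Space d → ℝ) :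
    ℝ × Space d → ℝ :=
  fun p => Real.exp (∫ s in 0..p.1, -c (s, p.2)) *
    (ubar p.2 + ∫ s in 0..p.1, Real.exp (∫ r in 0..s, c (r, p.2)) * f (s, p.2))

theorem exp_integral_le {k : ℝ → ℝ} {M t : ℝ} (hkM : ∀ t, ‖k t‖ ≤ M)
    (ht : t ∈ Icc 0 T) : Real.exp (∫ s in 0..t, k s) ≤ Real.exp (M * T) := by
  have hM : 0 ≤ M := (norm_nonneg _).trans (hkM 0)
  refine Real.exp_le_exp.2 ((Real.le_norm_self _).trans ?_)
  refine (intervalIntegral.norm_integral_le_of_norm_le_const fun s _ => hkM s).trans ?_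
  rw [sub_zero, abs_of_nonneg ht.1]
  exact mul_le_mul_of_nonneg_left ht.2 hM

/-- Both exponentials are at most `exp (M * T)`, so the formula is dominated by `exp (M * T) *
(|ubar| + exp (M * T) * ∫ |f|)`, which is square integrable by `memLp_integral_norm`. -/
theorem memLp_variationOfConstants (hT : 0 < T) (hD : IsBoundedLipschitzDomain D)
    {c f : ℝ × Space d → ℝ} {ubar : Space d → ℝ} {M : ℝ} (hc : Measurable c)
    (hcM : ∀ p, ‖c p‖ ≤ M) (hfm : Measurable f)
    (hf : MemLp f 2 (volume.restrict (cylinder T D)))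
    (hubar : MemLp ubar 2 (volume.restrict D)) :
    MemLp (variationOfConstants c f ubar) 2 (volume.restrict (cylinder T D)) := by
  have := isFiniteMeasure_restrict hD
  have := isFiniteMeasure_restrict_cylinder (T := T) hD
  have hE := (measurable_integral_fst hc).exp
  have hE' := (measurable_integral_fst hc.neg).exp
  have hH := measurable_integral_fst (hE.mul hfm)
  have hu : MemLp (fun p : ℝ × Space d => ubar p.2) 2 (volume.restrict (cylinder T D)) := by
    rw [volume_restrict_cylinder]
    exact hubar.comp_snd _
  have hN : MemLp (fun p : ℝ × Space d => ∫ s in Ioo 0 T, ‖f (s, p.2)‖) 2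
      (volume.restrict (cylinder T D)) := by
    rw [volume_restrict_cylinder]
    exact (memLp_integral_norm hT hD hf).comp_snd _
  refine ((hu.norm.add (hN.const_mul (Real.exp (M * T)))).const_mul (Real.exp (M * T))).mono'
    (hE'.aestronglyMeasurable.mul (hu.1.add hH.aestronglyMeasurable)) ?_
  have hint : ∀ᵐ x ∂(volume.restrict D), IntegrableOn (fun s => f (s, x)) (Ioo 0 T) := by
    have h := hf.integrable (q := 2) (by norm_num)
    rw [volume_restrict_cylinder] at h
    exact h.prod_left_ae
  filter_upwards [ae_restrict_cylinder_of_ae (T := T) hint,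
    ae_restrict_mem (measurableSet_cylinder hD)] with p hp hpm
  have ht := Ioo_subset_Icc_self hpm.1
  rw [variationOfConstants, norm_mul, Real.norm_of_nonneg (Real.exp_pos _).le]
  refine mul_le_mul (exp_integral_le (by simpa using fun t => hcM (t, p.2)) ht) ?_
    (norm_nonneg _) (Real.exp_pos _).le
  refine (norm_add_le _ _).trans (add_le_add_right ?_ _)
  rw [intervalIntegral.integral_of_le ht.1]
  beta_reduce
  rw [← integral_const_mul]
  have hsub : Ioc 0 p.1 ⊆ Ioo 0 T := fun s hs => ⟨hs.1, hs.2.trans_lt hpm.1.2⟩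
  have hi := (hp.norm.const_mul (Real.exp (M * T)))
  refine (norm_integral_le_of_norm_le (hi.mono_measure (Measure.restrict_mono_set _ hsub)) ?_).trans
    (setIntegral_mono_set hi (.of_forall fun s => by positivity) (LE.le.eventuallyLE hsub))
  refine (ae_restrict_iff' measurableSet_Ioc).2 (.of_forall fun s hs => ?_)
  rw [norm_mul, Real.norm_of_nonneg (Real.exp_pos _).le]
  refine mul_le_mul_of_nonneg_right ?_ (norm_nonneg _)
  exact exp_integral_le (fun t => hcM (t, p.2)) (Ioo_subset_Icc_self (hsub hs))

theorem IsSmoothTest.memLp_self (hD : IsBoundedLipschitzDomain D) {C V : ℝ × Space d → ℝ}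
    (hV : IsSmoothTest T D C V) (q : ℝ≥0∞) : MemLp V q (volume.restrict (cylinder T D)) := by
  have := isFiniteMeasure_restrict_cylinder (T := T) hD
  refine memLp_of_continuousOn_closedCylinder hD ?_ hV.continuousOn q
  filter_upwards [ae_restrict_mem (measurableSet_cylinder hD)] with p hp
  exact ⟨Ioo_subset_Icc_self hp.1, subset_closure hp.2⟩

theorem IsSmoothTest.memLp_trace (hT : 0 ≤ T) (hD : IsBoundedLipschitzDomain D)
    {C V : ℝ × Space d → ℝ} (hV : IsSmoothTest T D C V) (q : ℝ≥0∞) :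
    MemLp (fun x => V (0, x)) q (volume.restrict D) := by
  have := isFiniteMeasure_restrict hD
  have hc : ContinuousOn (fun x => V (0, x)) (closure D) :=
    hV.continuousOn.comp (by fun_prop) fun x hx => ⟨left_mem_Icc.2 hT, hx⟩
  obtain ⟨B, hB⟩ := hD.bounded.isCompact_closure.exists_bound_of_continuousOn hc
  refine MemLp.of_bound ((hc.mono subset_closure).aestronglyMeasurable hD.isOpen.measurableSet) B ?_
  exact (ae_restrict_iff' hD.isOpen.measurableSet).2
    (.of_forall fun x hx => hB x (subset_closure hx))

theorem IsSmoothTest.differentiableAt (hD : IsBoundedLipschitzDomain D)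
    {C V : ℝ × Space d → ℝ} (hV : IsSmoothTest T D C V) {x : Space d} (hx : x ∈ D) {t : ℝ}
    (ht : t ∈ Ioo 0 T) : DifferentiableAt ℝ (fun s => V (s, x)) t := by
  have h : DifferentiableAt ℝ V (t, x) :=
    (hV.contDiffOn.differentiableOn (by norm_num)).differentiableAt
      ((isOpen_Ioo.prod hD.isOpen).mem_nhds ⟨ht, hx⟩)
  exact h.comp (f := fun s : ℝ => (s, x)) t (by fun_prop)

/-- The variation of constants formula solves the weak equation for smooth test functions. -/
theorem integral_variationOfConstants_mul_formalAdjoint (hT : 0 < T)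
    (hD : IsBoundedLipschitzDomain D)
    {c f : ℝ × Space d → ℝ} {ubar : Space d → ℝ} {M : ℝ} (hc : Measurable c)
    (hcM : ∀ p, ‖c p‖ ≤ M) (hfm : Measurable f)
    (hf : MemLp f 2 (volume.restrict (cylinder T D)))
    (hubar : MemLp ubar 2 (volume.restrict D)) {V : ℝ × Space d → ℝ}
    (hV : IsSmoothTest T D c V) :
    ∫ p in cylinder T D, variationOfConstants c f ubar p * formalAdjoint c V p =
      (∫ p in cylinder T D, f p * V p) + ∫ x in D, ubar x * V (0, x) := by
  have := isFiniteMeasure_restrict hD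
  have := isFiniteMeasure_restrict_cylinder (T := T) hD
  have h1 := (memLp_variationOfConstants hT hD hc hcM hfm hf hubar).integrable_mul hV.memLp
  have h2 := hf.integrable_mul (hV.memLp_self hD 2)
  have h3 := hubar.integrable_mul (hV.memLp_trace hT.le hD 2)
  have hfi := hf.integrable (q := 2) (by norm_num)
  have hgi := hV.memLp.integrable (q := 2) (by norm_num)
  rw [volume_restrict_cylinder] at h1 h2 hfi hgi ⊢
  -- Fubini with time as the inner variable: on almost every line of fixed `x` the identity is the
  -- scalar one.
  refine (integral_prod_symm _ h1).trans ?_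
  refine Eq.trans ?_ (congrArg (· + _) (integral_prod_symm _ h2).symm)
  refine Eq.trans ?_ (integral_add h2.integral_prod_right h3)
  refine integral_congr_ae ?_
  filter_upwards [ae_restrict_mem hD.isOpen.measurableSet, hfi.prod_left_ae, hgi.prod_left_ae]
    with x hx hfx hgx
  exact integral_variationOfConstants_mul hT.le (hc.comp measurable_prodMk_right)
    (fun t => hcM (t, x)) hfx
    (hV.continuousOn.comp (by fun_prop) fun t ht => ⟨ht, subset_closure hx⟩)
    (fun t ht => hV.differentiableAt hD hx ht) hgx (hV.terminal x (subset_closure hx)) (ubar x)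

theorem tendsto_integral_mul {α : Type*} [MeasurableSpace α] {μ : Measure α} {u v : α → ℝ}
    {w : ℕ → α → ℝ} (hu : MemLp u 2 μ) (hv : MemLp v 2 μ) (hw : ∀ n, MemLp (w n) 2 μ)
    (h : Tendsto (fun n => eLpNorm (w n - v) 2 μ) atTop (𝓝 0)) :
    Tendsto (fun n => ∫ x, u x * w n x ∂μ) atTop (𝓝 (∫ x, u x * v x ∂μ)) := by
  have key : ∀ {g : α → ℝ} (hg : MemLp g 2 μ),
      ∫ x, u x * g x ∂μ = inner ℝ (hu.toLp u) (hg.toLp g) := by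
    intro g hg
    rw [L2.inner_def]
    refine integral_congr_ae ?_
    filter_upwards [hu.coeFn_toLp, hg.coeFn_toLp] with x h1 h2
    simp [h1, h2, mul_comm]
  rw [← Lp.tendsto_Lp_iff_tendsto_eLpNorm'' w hw v hv] at h
  simp_rw [key (hw _), key hv]
  exact tendsto_const_nhds.inner h

/-- It suffices to check the variational equation for smooth test functions. -/
theorem isVariationalSolution_of_smooth (hT : 0 ≤ T) (hD : IsBoundedLipschitzDomain D)
    {C F U : ℝ × Space d → ℝ} {ubar : Space d → ℝ}
    (hF : MemLp F 2 (volume.restrict (cylinder T D))) (hubar : MemLp ubar 2 (volume.restrict D))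
    (hU : MemLp U 2 (volume.restrict (cylinder T D)))
    (h : ∀ V, IsSmoothTest T D C V → ∫ p in cylinder T D, U p * formalAdjoint C V p =
      (∫ p in cylinder T D, F p * V p) + ∫ x in D, ubar x * V (0, x)) :
    IsVariationalSolution T D C F ubar U := by
  refine ⟨hU, fun V G V₀ hV => ?_⟩
  obtain ⟨W, hW, h1, h2, h3⟩ := hV.approx
  have t1 := tendsto_integral_mul hF hV.memLp (fun n => (hW n).memLp_self hD 2) h1
  have t2 := tendsto_integral_mul hU hV.memLp_adjoint (fun n => (hW n).memLp) h2
  have t3 := tendsto_integral_mul hubar hV.memLp_trace (fun n => (hW n).memLp_trace hT hD 2) h3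
  exact tendsto_nhds_unique t2 ((t1.add t3).congr fun n => (h (W n) (hW n)).symm)

theorem formalAdjoint_congr_ae {C C' V : ℝ × Space d → ℝ} {μ : Measure (ℝ × Space d)}
    (h : C =ᵐ[μ] C') : formalAdjoint C V =ᵐ[μ] formalAdjoint C' V :=
  h.mono fun p hp => by simp [formalAdjoint, hp]

theorem IsSmoothTest.congr {C C' V : ℝ × Space d → ℝ}
    (h : C =ᵐ[volume.restrict (cylinder T D)] C') (hV : IsSmoothTest T D C V) :
    IsSmoothTest T D C' V :=
  ⟨hV.continuousOn, hV.contDiffOn, hV.terminal,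
    (memLp_congr_ae (formalAdjoint_congr_ae h)).1 hV.memLp⟩

theorem IsSmoothTest.inTestSpace (hT : 0 ≤ T) (hD : IsBoundedLipschitzDomain D)
    {C V : ℝ × Space d → ℝ} (hV : IsSmoothTest T D C V) :
    InTestSpace T D C V (formalAdjoint C V) fun x => V (0, x) :=
  ⟨hV.memLp_self hD 2, hV.memLp, hV.memLp_trace hT hD 2, fun _ => V, fun _ => hV,
    by simp, by simp, by simp⟩

/-- An essentially bounded function has a measurable representative that is bounded everywhere. -/
theorem exists_measurable_bounded_ae_eq {α : Type*} [MeasurableSpace α] {μ : Measure α}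
    {C : α → ℝ} (hC : MemLp C ∞ μ) :
    ∃ (C' : α → ℝ) (M : ℝ), Measurable C' ∧ (∀ p, ‖C' p‖ ≤ M) ∧ C =ᵐ[μ] C' := by
  let M := (eLpNormEssSup C μ).toReal
  have hM : 0 ≤ M := ENNReal.toReal_nonneg
  let m := hC.1.mk C
  have hm : Measurable m := hC.1.stronglyMeasurable_mk.measurable
  refine ⟨fun p => max (-M) (min M (m p)), M, by fun_prop, fun p => ?_, ?_⟩
  · rw [Real.norm_eq_abs, abs_le]
    exact ⟨le_max_left _ _, max_le (by linarith) (min_le_left _ _)⟩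
  · have hb : ∀ᵐ p ∂μ, ‖C p‖ ≤ M := by
      filter_upwards [enorm_ae_le_eLpNormEssSup C μ] with p hp
      have hfin : eLpNormEssSup C μ ≠ ∞ := by simpa using hC.2.ne
      have := ENNReal.toReal_mono hfin hp
      simpa using this
    filter_upwards [hb, hC.1.ae_eq_mk] with p h1 h2
    rw [Real.norm_eq_abs, abs_le] at h1
    rw [show m p = C p from h2.symm, min_eq_right h1.2, max_eq_right h1.1]

/-- The formula integrates along single lines, so it is applied to measurable representatives, with
the coefficient bounded everywhere; the weak equation does not see the change on null sets. -/
theorem exists_isVariationalSolution (hT : 0 < T) (hD : IsBoundedLipschitzDomain D)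
    {C F : ℝ × Space d → ℝ} {ubar : Space d → ℝ}
    (hC : MemLp C ∞ (volume.restrict (cylinder T D)))
    (hF : MemLp F 2 (volume.restrict (cylinder T D))) (hubar : MemLp ubar 2 (volume.restrict D)) :
    ∃ U, IsVariationalSolution T D C F ubar U := by
  obtain ⟨c, M, hc, hcM, hCc⟩ := exists_measurable_bounded_ae_eq hC
  have hfm := hF.1.stronglyMeasurable_mk.measurable
  have hFf := hF.1.ae_eq_mk
  have hf := (memLp_congr_ae hFf).1 hF
  refine ⟨_, isVariationalSolution_of_smooth hT.le hD hF hubar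
    (memLp_variationOfConstants hT hD hc hcM hfm hf hubar) fun V hV => ?_⟩
  have h := integral_variationOfConstants_mul_formalAdjoint hT hD hc hcM hfm hf hubar
    (hV.congr hCc)
  refine Eq.trans ?_ (h.trans ?_)
  · exact integral_congr_ae ((formalAdjoint_congr_ae (V := V) hCc).mono fun p hp => by simp only [hp])
  · congr 1
    exact integral_congr_ae (hFf.mono fun p hp => by simp only [hp])

/-! ### Uniqueness of variational solutions -/

open scoped ContDiff


/-- Integrating the translates of a compactly supported `C^1` function along a segment gives a
`C^1` function. -/
theorem contDiff_integral_translate {E : Type*} [NormedAddCommGroup E] [NormedSpace ℝ E]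
    {g : E → ℝ} (hg : ContDiff ℝ 1 g) (hgc : HasCompactSupport g) (e : E) (a b : ℝ) :
    ContDiff ℝ 1 fun p => ∫ r in a..b, g (p + r • e) := by
  have hd := hg.continuous_fderiv one_ne_zero
  obtain ⟨B, hB⟩ := hd.bounded_above_of_compact_support (hgc.fderiv ℝ)
  have hg0 := hg.continuous
  rw [contDiff_one_iff_hasFDerivAt]
  refine ⟨fun p => ∫ r in a..b, fderiv ℝ g (p + r • e), ?_, fun p => ?_⟩
  · exact intervalIntegral.continuous_parametric_intervalIntegral_of_continuous'
      (f := fun p (r : ℝ) => fderiv ℝ g (p + r • e)) (by fun_prop) a b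
  · refine intervalIntegral.hasFDerivAt_integral_of_dominated_of_fderiv_le
      (F := fun p (r : ℝ) => g (p + r • e)) (F' := fun p (r : ℝ) => fderiv ℝ g (p + r • e))
      (bound := fun _ => B) univ_mem
      (.of_forall fun q => (show Continuous fun r : ℝ => g (q + r • e) by
        fun_prop).aestronglyMeasurable)
      ((show Continuous fun r : ℝ => g (p + r • e) by fun_prop).intervalIntegrable _ _)
      ((show Continuous fun r : ℝ => fderiv ℝ g (p + r • e) by fun_prop).aestronglyMeasurable)
      (.of_forall fun r _ q _ => hB _) (by simp) (.of_forall fun r _ q _ => ?_)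
    have h := ((hg.differentiable one_ne_zero) (q + r • e)).hasFDerivAt
    simpa using! h.comp q ((hasFDerivAt_id q).add_const (r • e))

/-- The solution of `-∂_t V = g` vanishing at time `T`, for `g` supported before time `T`. -/
noncomputable def backwardPrimitive (T : ℝ) (g : ℝ × Space d → ℝ) : ℝ × Space d → ℝ :=
  fun p => ∫ r in 0..T, g (p + r • ((1 : ℝ), (0 : Space d)))

/-- The window `[t, t + T]` replaces `[t, T]`: its fixed length allows differentiation under an
integral with constant limits. For `0 ≤ t ≤ T` the two integrals agree when `g` vanishes after time
`T`. -/
theorem backwardPrimitive_eq (g : ℝ × Space d → ℝ) (t : ℝ) (x : Space d) :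
    backwardPrimitive T g (t, x) = ∫ s in t..t + T, g (s, x) := by
  rw [backwardPrimitive]
  have := intervalIntegral.integral_comp_add_left (a := 0) (b := T) (fun s => g (s, x)) t
  simpa using this

theorem hasDerivAt_backwardPrimitive {g : ℝ × Space d → ℝ} (hg : Continuous g) {t : ℝ}
    {x : Space d} (h : g (t + T, x) = 0) :
    HasDerivAt (fun s => backwardPrimitive T g (s, x)) (-g (t, x)) t := by
  have hc : Continuous fun s => g (s, x) := by fun_prop
  have hi : ∀ a b, IntervalIntegrable (fun s => g (s, x)) volume a b :=
    fun a b => hc.intervalIntegrable a b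
  have h1 : ∀ s, backwardPrimitive T g (s, x) =
      (∫ r in 0..s + T, g (r, x)) - ∫ r in 0..s, g (r, x) := fun s => by
    rw [backwardPrimitive_eq, intervalIntegral.integral_interval_sub_left (hi _ _) (hi _ _)]
  simp_rw [h1]
  have h2 := hc.integral_hasStrictDerivAt 0 t
  have h3 := (hc.integral_hasStrictDerivAt 0 (t + T)).hasDerivAt.comp_add_const t T
  simpa [h] using h3.fun_sub h2.hasDerivAt

/-- Every smooth function with compact support in the cylinder is `-∂_t V` for a smooth test
function `V`. -/
theorem isSmoothTest_backwardPrimitive (hD : IsBoundedLipschitzDomain D)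
    {c g : ℝ × Space d → ℝ} (hc : MemLp c ∞ (volume.restrict (cylinder T D)))
    (hg : ContDiff ℝ ∞ g) (hgc : HasCompactSupport g) (hgs : tsupport g ⊆ cylinder T D) :
    IsSmoothTest T D c (backwardPrimitive T g) ∧
      ∀ p ∈ cylinder T D,
        formalAdjoint c (backwardPrimitive T g) p = g p + c p * backwardPrimitive T g p := by
  have := isFiniteMeasure_restrict_cylinder (T := T) hD
  have h0 : ∀ p ∉ cylinder T D, g p = 0 := fun p hp =>
    image_eq_zero_of_notMem_tsupport fun h => hp (hgs h)
  have hV : ContDiff ℝ 1 (backwardPrimitive T g) :=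
    contDiff_integral_translate (hg.of_le (by norm_cast)) hgc _ 0 T
  have hadj : ∀ p ∈ cylinder T D,
      formalAdjoint c (backwardPrimitive T g) p = g p + c p * backwardPrimitive T g p := by
    intro p hp
    have h := hasDerivAt_backwardPrimitive (T := T) hg.continuous (t := p.1) (x := p.2)
      -- For `t > 0` the upper end `t + T` lies beyond the support of `g`.
      (h0 _ fun h => by have := h.1.2; have := hp.1.1; simp at *; linarith)
    rw [formalAdjoint, h.deriv, neg_neg]
  refine ⟨⟨hV.continuous.continuousOn, hV.contDiffOn, fun x _ => ?_, ?_⟩, hadj⟩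
  · rw [backwardPrimitive]
    refine intervalIntegral.integral_zero_ae (.of_forall fun r hr => h0 _ fun h => ?_)
    have h1 := h.1
    rcases le_total 0 T with hT | hT
    · rw [uIoc_of_le hT] at hr
      have := h1.2
      simp at this
      linarith [hr.1]
    · have := h1.1.trans h1.2
      linarith
  · have hq : (fun p => g p + c p * backwardPrimitive T g p) =ᵐ[volume.restrict (cylinder T D)]
        formalAdjoint c (backwardPrimitive T g) := by
      filter_upwards [ae_restrict_mem (measurableSet_cylinder hD)] with p hp
      exact (hadj p hp).symm
    have hae : ∀ᵐ p ∂(volume.restrict (cylinder T D)), p ∈ closedCylinder T D := by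
      filter_upwards [ae_restrict_mem (measurableSet_cylinder hD)] with p hp
      exact ⟨Ioo_subset_Icc_self hp.1, subset_closure hp.2⟩
    refine (memLp_congr_ae hq).1 (MemLp.add ?_ ?_)
    · exact memLp_of_continuousOn_closedCylinder hD hae hg.continuous.continuousOn 2
    · exact (memLp_of_continuousOn_closedCylinder hD hae hV.continuous.continuousOn 2).mul hc

/-- Integration by parts on one time line. -/
theorem integral_mul_backwardPrimitive (hT : 0 ≤ T) {g : ℝ × Space d → ℝ} (hg : ContDiff ℝ 1 g)
    (hgc : HasCompactSupport g) {x : Space d} (h0 : ∀ s, T ≤ s → g (s, x) = 0) {k : ℝ → ℝ}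
    (hk : IntegrableOn k (Ioo 0 T)) :
    ∫ t in Ioo 0 T, k t * backwardPrimitive T g (t, x) =
      ∫ t in Ioo 0 T, (∫ s in 0..t, k s) * g (t, x) := by
  have hI : ∀ φ : ℝ → ℝ, ∫ t in Ioo 0 T, φ t = ∫ t in 0..T, φ t := fun φ => by
    rw [intervalIntegral.integral_of_le hT, integral_Ioc_eq_integral_Ioo]
  rw [← intervalIntegrable_iff_integrableOn_Ioo_of_le hT] at hk
  have hA := hk.absolutelyContinuousOnInterval_intervalIntegral (c := 0) (by simp)
  have hV : ContDiff ℝ 1 fun t => backwardPrimitive T g (t, x) :=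
    (contDiff_integral_translate hg hgc _ 0 T).comp (by fun_prop)
  have hparts := hA.integral_mul_deriv_eq_deriv_mul
    (hV.contDiffOn (s := uIcc 0 T)).absolutelyContinuousOnInterval
  have hVT : backwardPrimitive T g (T, x) = 0 := by
    rw [backwardPrimitive_eq]
    refine intervalIntegral.integral_zero_ae (.of_forall fun s hs => h0 s ?_)
    rw [uIoc_of_le (by linarith)] at hs
    exact hs.1.le
  have h1 : ∫ t in 0..T, (∫ s in 0..t, k s) * deriv (fun t => backwardPrimitive T g (t, x)) t =
      -∫ t in 0..T, (∫ s in 0..t, k s) * g (t, x) := by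
    rw [← intervalIntegral.integral_neg]
    refine intervalIntegral.integral_congr_ae (.of_forall fun t ht => ?_)
    rw [uIoc_of_le hT] at ht
    rw [(hasDerivAt_backwardPrimitive hg.continuous (h0 _ (by linarith [ht.1]))).deriv]
    ring
  have h2 : ∫ t in 0..T, deriv (fun t => ∫ s in 0..t, k s) t * backwardPrimitive T g (t, x) =
      ∫ t in 0..T, k t * backwardPrimitive T g (t, x) := by
    refine intervalIntegral.integral_congr_ae ?_
    filter_upwards [hk.ae_hasDerivAt_integral] with t h3 ht
    rw [(h3 (uIoc_subset_uIcc ht) 0 (by simp)).deriv]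
  rw [h1, h2, hVT] at hparts
  rw [hI, hI]
  simpa using hparts.symm

theorem integrable_integral_fst (hD : IsBoundedLipschitzDomain D) {k : ℝ × Space d → ℝ}
    (hkm : Measurable k) (hk : Integrable k (volume.restrict (cylinder T D))) :
    Integrable (fun p : ℝ × Space d => ∫ s in 0..p.1, k (s, p.2))
      (volume.restrict (cylinder T D)) := by
  have := isFiniteMeasure_restrict hD
  have hk' := hk
  rw [volume_restrict_cylinder] at hk'
  have hN : Integrable (fun p : ℝ × Space d => ∫ s in Ioo 0 T, ‖k (s, p.2)‖)
      (volume.restrict (cylinder T D)) := by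
    rw [volume_restrict_cylinder]
    exact hk'.norm.integral_prod_right.comp_snd _
  refine hN.mono' (measurable_integral_fst hkm).aestronglyMeasurable ?_
  filter_upwards [ae_restrict_cylinder_of_ae (T := T) hk'.prod_left_ae,
    ae_restrict_mem (measurableSet_cylinder hD)] with p hp hpm
  rw [intervalIntegral.integral_of_le hpm.1.1.le]
  refine (norm_integral_le_integral_norm _).trans
    (setIntegral_mono_set hp.norm (.of_forall fun s => norm_nonneg _) ?_)
  exact LE.le.eventuallyLE fun s hs => ⟨hs.1, hs.2.trans_lt hpm.1.2⟩

/-- The adjoint operator has dense range on smooth test functions. -/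
theorem ae_eq_zero_of_integral_mul_formalAdjoint (hT : 0 < T) (hD : IsBoundedLipschitzDomain D)
    {c W : ℝ × Space d → ℝ} {M : ℝ} (hc : Measurable c) (hcM : ∀ p, ‖c p‖ ≤ M)
    (hWm : Measurable W) (hW : MemLp W 2 (volume.restrict (cylinder T D)))
    (h : ∀ V, IsSmoothTest T D c V → ∫ p in cylinder T D, W p * formalAdjoint c V p = 0) :
    W =ᵐ[volume.restrict (cylinder T D)] 0 := by
  have := isFiniteMeasure_restrict hD
  have := isFiniteMeasure_restrict_cylinder (T := T) hD
  have hQ := measurableSet_cylinder (T := T) hD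
  have hWi := hW.integrable (q := 2) (by norm_num)
  have hkm : Measurable fun p => W p * c p := hWm.mul hc
  have hki : Integrable (fun p => W p * c p) (volume.restrict (cylinder T D)) :=
    hWi.mul_bdd (c := M) hc.aestronglyMeasurable (.of_forall hcM)
  have hki' := hki
  rw [volume_restrict_cylinder] at hki'
  let P : ℝ × Space d → ℝ := fun p => ∫ s in 0..p.1, W (s, p.2) * c (s, p.2)
  have hPm : Measurable P := measurable_integral_fst hkm
  have hPi : Integrable P (volume.restrict (cylinder T D)) := integrable_integral_fst hD hkm hki
  -- Test with `V = backwardPrimitive T g`, whose adjoint is `g + c V`. Integrating by parts on each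
  -- time line turns `∫ W c V` into `∫ P g`, so `W + P` annihilates every bump function `g`.
  have hweak : ∀ g : ℝ × Space d → ℝ, ContDiff ℝ ∞ g → HasCompactSupport g →
      tsupport g ⊆ cylinder T D → ∫ p, g p • (W p + P p) = 0 := by
    intro g hg hgc hgs
    have h0 : ∀ p ∉ cylinder T D, g p = 0 := fun p hp =>
      image_eq_zero_of_notMem_tsupport fun h => hp (hgs h)
    have hg1 : ContDiff ℝ 1 g := hg.of_le (by norm_cast)
    obtain ⟨B, hB⟩ := hg.continuous.bounded_above_of_compact_support hgc
    have hV : ContDiff ℝ 1 (backwardPrimitive T g) := contDiff_integral_translate hg1 hgc _ 0 T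
    obtain ⟨hVt, hadj⟩ := isSmoothTest_backwardPrimitive hD
      (MemLp.of_bound hc.aestronglyMeasurable M (.of_forall hcM)) hg hgc hgs
    have hgm := hg.continuous.aestronglyMeasurable (μ := volume.restrict (cylinder T D))
    have i1 : Integrable (fun p => W p * g p) (volume.restrict (cylinder T D)) :=
      hWi.mul_bdd (c := B) hgm (.of_forall hB)
    have i2 : Integrable (fun p => P p * g p) (volume.restrict (cylinder T D)) :=
      hPi.mul_bdd (c := B) hgm (.of_forall hB)
    have i3 : Integrable (fun p => W p * c p * backwardPrimitive T g p)
        (volume.restrict (cylinder T D)) :=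
      hki.mul_of_top_left (hVt.memLp_self hD ∞)
    have e1 : ∫ p in cylinder T D, W p * c p * backwardPrimitive T g p =
        ∫ p in cylinder T D, P p * g p := by
      rw [volume_restrict_cylinder] at i2 i3 ⊢
      rw [integral_prod_symm _ i3, integral_prod_symm _ i2]
      refine integral_congr_ae ?_
      filter_upwards [hki'.prod_left_ae] with x hx
      exact integral_mul_backwardPrimitive hT.le hg1 hgc
        (fun s hs => h0 _ fun h => absurd h.1.2 (not_lt.2 hs)) hx
    have e2 := h _ hVt
    rw [setIntegral_congr_fun hQ (g := fun p => W p * g p + W p * c p * backwardPrimitive T g p)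
      (fun p hp => by simp only [hadj p hp]; ring), integral_add i1 i3, e1,
      ← integral_add i1 i2] at e2
    rw [← setIntegral_eq_integral_of_forall_compl_eq_zero (s := cylinder T D)
      (fun p hp => by simp [h0 p hp]), ← e2]
    congr 1
    ext p
    simp only [smul_eq_mul]
    ring
  have hzero : ∀ᵐ p ∂(volume.restrict (cylinder T D)), W p + P p = 0 := by
    rw [ae_restrict_iff' hQ]
    refine (isOpen_Ioo.prod hD.isOpen).ae_eq_zero_of_integral_contDiff_smul_eq_zero ?_ hweak
    exact IntegrableOn.locallyIntegrableOn (hWi.add hPi)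
  have hm1 : MeasurableSet {p : ℝ × Space d | W p + P p = 0} :=
    measurableSet_eq_fun (hWm.add hPm) measurable_const
  have hm2 : MeasurableSet {p : ℝ × Space d | W p = 0} :=
    measurableSet_eq_fun hWm measurable_const
  change ∀ᵐ p ∂(volume.restrict (cylinder T D)), W p = 0
  have hWi' := hWi
  rw [volume_restrict_cylinder] at hzero hWi' ⊢
  -- Exchanging the almost-everywhere quantifiers turns the space-time statement into one on almost
  -- every line of fixed `x`, where the scalar uniqueness result applies.
  rw [Measure.ae_prod_iff_ae_ae hm1, Measure.ae_ae_comm (by exact hm1)] at hzero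
  rw [Measure.ae_prod_iff_ae_ae hm2, Measure.ae_ae_comm (by exact hm2)]
  filter_upwards [hzero, hWi'.prod_left_ae] with x hx hxi
  exact ae_eq_zero_of_add_integral_eq_zero (c := fun t => c (t, x)) hT.le
    (hc.comp measurable_prodMk_right) (fun t => hcM (t, x)) hxi hx

theorem IsVariationalSolution.ae_eq (hT : 0 < T) (hD : IsBoundedLipschitzDomain D)
    {C F U U' : ℝ × Space d → ℝ} {ubar : Space d → ℝ}
    (hC : MemLp C ∞ (volume.restrict (cylinder T D)))
    (hU : IsVariationalSolution T D C F ubar U) (hU' : IsVariationalSolution T D C F ubar U') :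
    U =ᵐ[volume.restrict (cylinder T D)] U' := by
  obtain ⟨c, M, hc, hcM, hCc⟩ := exists_measurable_bounded_ae_eq hC
  have hW := hU.memLp.sub hU'.memLp
  have hWw := hW.1.ae_eq_mk
  have key : hW.1.mk (U - U') =ᵐ[volume.restrict (cylinder T D)] 0 := by
    refine ae_eq_zero_of_integral_mul_formalAdjoint hT hD hc hcM
      hW.1.stronglyMeasurable_mk.measurable ((memLp_congr_ae hWw).1 hW) fun V hV => ?_
    have hV' := hV.congr hCc.symm
    have e1 := hU.variational _ _ _ (hV'.inTestSpace hT.le hD)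
    have e2 := hU'.variational _ _ _ (hV'.inTestSpace hT.le hD)
    have e3 := integral_sub (hU.memLp.integrable_mul hV'.memLp)
      (hU'.memLp.integrable_mul hV'.memLp)
    simp only [Pi.mul_apply] at e3
    rw [e1, e2, sub_self] at e3
    rw [← e3]
    refine integral_congr_ae ?_
    filter_upwards [hWw, formalAdjoint_congr_ae (V := V) hCc] with p h1 h2
    rw [← h1, ← h2, Pi.sub_apply, sub_mul]
  filter_upwards [hWw.trans key] with p hp
  exact sub_eq_zero.1 hp

end FlowTransport

/-! ### Existence and uniqueness of the flow-solution -/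

theorem mainTheorem2 {d : ℕ} (T : ℝ) (hT : 0 < T)
    (D : Set (FlowTransport.Space d)) (hD : FlowTransport.IsBoundedLipschitzDomain D)
    (b : ℝ × FlowTransport.Space d → FlowTransport.Space d)
    (hb : MemLp b ∞ (volume.restrict (FlowTransport.closedCylinder T D)))
    (X : ℝ → FlowTransport.Space d → FlowTransport.Space d)
    (hX : FlowTransport.IsForwardUntangledFlow T D b X)
    (c f : ℝ × FlowTransport.Space d → ℝ) (ubar : FlowTransport.Space d → ℝ)
    (hc : MemLp c ∞ (FlowTransport.spaceTimeMeasure T D X))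
    (hc_nonneg : ∀ᵐ p ∂(FlowTransport.spaceTimeMeasure T D X), 0 ≤ c p)
    (hf : MemLp f 2 (FlowTransport.spaceTimeMeasure T D X))
    (hubar : MemLp ubar 2 (volume.restrict D)) :
    ∃! u : Lp ℝ 2 (FlowTransport.spaceTimeMeasure T D X),
      FlowTransport.IsFlowSolution T D X c f ubar u := by
  open FlowTransport in
  obtain ⟨Φ, hΦ, hΦX⟩ := exists_measurePreserving_alongFlow hT hD hX
  have hfinQ := isFiniteMeasure_restrict_cylinder (T := T) hD
  have hfin : IsFiniteMeasure (spaceTimeMeasure T D X) := by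
    rw [← hΦ.map_eq]; infer_instance
  have hσ := ae_mem_closedCylinder hD hX hΦ hΦX
  have hflow : ∀ g : ℝ × Space d → ℝ,
      g ∘ Φ =ᵐ[volume.restrict (cylinder T D)] alongFlow X g := fun g => by
    filter_upwards [ae_restrict_mem (measurableSet_cylinder hD)] with p hp
    simp [alongFlow, hΦX p hp]
  have hC : MemLp (alongFlow X c) ∞ (volume.restrict (cylinder T D)) :=
    (memLp_congr_ae (hflow c)).1 (hc.comp_measurePreserving hΦ)
  have hF : MemLp (alongFlow X f) 2 (volume.restrict (cylinder T D)) :=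
    (memLp_congr_ae (hflow f)).1 (hf.comp_measurePreserving hΦ)
  obtain ⟨U, hU⟩ := exists_isVariationalSolution hT hD hC hF hubar
  obtain ⟨u, hu⟩ := exists_Lp_integral_mul_eq hΦ hU.memLp
  have hgen : ∀ φ : ℝ × Space d → ℝ, ContinuousOn φ (closedCylinder T D) →
      ∫ p, u p * φ p ∂(spaceTimeMeasure T D X) =
        ∫ p in cylinder T D, U p * alongFlow X φ p := fun φ hφ => by
    rw [hu φ (memLp_of_continuousOn_closedCylinder hD hσ hφ 2)]
    refine integral_congr_ae ?_
    filter_upwards [hflow φ] with p hp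
    rw [← hp, Function.comp_apply]
  refine ⟨u, ⟨Lp.memLp u, U, hU, hgen⟩, fun v hv => ?_⟩
  obtain ⟨U', hU', hv'⟩ := hv.generated
  -- The function `U'` generating `v` equals `U` almost everywhere, so `u` and `v` have the same
  -- integrals against continuous functions.
  refine Lp.ext (ae_eq_of_integral_mul_continuous_eq hv.memLp (Lp.memLp u) fun φ hφ => ?_)
  rw [hgen φ hφ.continuousOn, hv' φ hφ.continuousOn]
  refine integral_congr_ae ?_
  filter_upwards [hU'.ae_eq hT hD hC hU] with p hp
  rw [hp]
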